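/- \textbf{Lemma (Ultimate boundedness of perturbed systems).} Let $\mathbb U=\{u\in\mathbb R^m: u_{\min,i}\le u_i\le u_{\max,i},\ i=1,\dots,m\}$ be a box containing $0$ in its interior, let $f:\mathbb R^n\times\mathbb U\to\mathbb R^n$ be $C^1$ with $f(0,0)=0$, and let $\mathcal L(x,u)=q(x)+u^{T}Ru$ with $q:\mathbb R^n\to[0,\infty)$ smooth, $q(0)=0$, and $R$ symmetric positive definite. Let $u^*:\mathbb R^n\to\mathbb U$ be an optimal feedback for the problem of minimizing $\int_0^\infty\mathcal L(x,u)\,dt$ subject to $\dot x=f(x,u)$, $x(0)=x_0$, $u(t)\in\mathbb U$; that is, from every $x_0\in\mathbb R^n$ it generates a closed-loop trajectory whose cost is finite and minimal. Put $f^*_{\rm cl}(x)=f(x,u^*(x))$, let $\mathbb B_\rho=\{x\in\mathbb R^n:\|x\|_2<\rho\}$, fix $r>0$, and suppose that (1) the Jacobian of $f^*_{\rm cl}$ exists and is Lipschitz throughout $\overline{\mathbb B}_r$; (2) $0$ is an exponentially stable equilibrium of $\dot x=f^*_{\rm cl}(x)$: $f^*_{\rm cl}(0)=0$ and there are $c,k,\lambda>0$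 such that every solution with $\|x(0)\|_2<c$ satisfies $\|x(t)\|_2\le k\|x(0)\|_2e^{-\lambda t}$ for all $t\ge0$ in its interval of existence. Then there are $\rho\in(0,r]$, constants $k_1,k_2,k_3,k_4>0$ and a $C^1$ function $W:\mathbb B_\rho\to[0,\infty)$ such that for all $x\in\mathbb B_\rho$ $$k_1\|x\|_2^2\le W(x)\le k_2\|x\|_2^2,\qquad \frac{\partial W}{\partial x}(x)\,f^*_{\rm cl}(x)\le-k_3\|x\|_2^2,\qquad \Big\|\frac{\partial W}{\partial x}(x)\Big\|_2\le k_4\|x\|_2, \tag{$*$}$$ and there is $L_u>0$ with $\|f(x,u)-f(x,v)\|_2\le L_u\|u-v\|_2$ for all $x\in\overline{\mathbb B}_r$ and $u,v\in\mathbb U$. Moreover, for every $\rho\in(0,r]$, all $W,k_1,\dots,k_4$ satisfying $(*)$ on $\mathbb B_\rho$, every such $L_u$ and every $\theta\in(0,1)$, the following holds. Let $\widehat u:\mathbb R^n\to\mathbb U$ be continuous with $$\delta:=\sup_{x\in\overline{\mathbb B}_r}\|\widehat u(x)-u^*(x)\|_2<\delta^+:=\frac{\theta k_3}{L_uk_4}\sqrt{\frac{k_1}{k_2}}\;\rho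 ,$$ and let $\|x_0\|_2<\rho\sqrt{k_1/k_2}$. Then the closed-loop system $\dot x=f(x,\widehat u(x))$, $x(0)=x_0$, has a solution on $[0,\infty)$, and each of its solutions on an interval $[0,S)$, $0<S<\infty$, extends to a solution on $[0,\infty)$. With $$K=\sqrt{\frac{k_2}{k_1}},\qquad \alpha=\frac{(1-\theta)k_3}{2k_2},\qquad B=\frac{L_uk_4}{\theta k_3}\sqrt{\frac{k_2}{k_1}}\;\delta ,$$ if $\delta>0$ there is a finite time $T=T(x_0)\ge0$ such that every solution $x$ on $[0,\infty)$ satisfies $$\|x(t)\|_2\le K\|x_0\|_2e^{-\alpha t}\quad(0\le t<T),\qquad \|x(t)\|_2\le B\quad(t\ge T),$$ and if $\delta=0$ the first estimate holds for all $t\ge0$. -/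

import Mathlib

open MeasureTheory Set
open scoped NNReal ENNReal Matrix

/-- The data of the infinite-horizon optimal control problem
`minimise ∫₀^∞ L(x, u) dt` subject to `ẋ = f(x, u)`, `x(0) = x₀`, `u(t) ∈ U`,
with objective equilibrium `(x_f, u_f) = (0, 0)`, box constraint set
`U = {u | uMin ≤ u ≤ uMax}` and running cost `L(x, u) = q(x) + uᵀ R u`.
Only the values of `f` on `ℝⁿ × U` matter. -/
structure OptimalControlProblem (n m : ℕ) where
  f : EuclideanSpace ℝ (Fin n) → EuclideanSpace ℝ (Fin m) → EuclideanSpace ℝ (Fin n)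
  uMin : Fin m → ℝ
  uMax : Fin m → ℝ
  q : EuclideanSpace ℝ (Fin n) → ℝ
  R : Matrix (Fin m) (Fin m) ℝ
  f_contDiffOn : ContDiffOn ℝ 1
    (fun p : EuclideanSpace ℝ (Fin n) × EuclideanSpace ℝ (Fin m) => f p.1 p.2)
    (univ ×ˢ {u | ∀ i, uMin i ≤ u i ∧ u i ≤ uMax i})
  f_zero : f 0 0 = 0
  zero_mem_interior :
    (0 : EuclideanSpace ℝ (Fin m)) ∈ interior {u | ∀ i, uMin i ≤ u i ∧ u i ≤ uMax i}
  q_smooth : ContDiff ℝ (⊤ : ℕ∞) q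
  q_nonneg : ∀ x, 0 ≤ q x
  q_zero : q 0 = 0
  R_posDef : R.PosDef

namespace OptimalControlProblem

variable {n m : ℕ} (P : OptimalControlProblem n m)

/-- The box of admissible control values. -/
def controlSet : Set (EuclideanSpace ℝ (Fin m)) :=
  {u | ∀ i, P.uMin i ≤ u i ∧ u i ≤ P.uMax i}

/-- The running cost `q(x) + uᵀ R u`. -/
def runningCost (x : EuclideanSpace ℝ (Fin n)) (u : EuclideanSpace ℝ (Fin m)) : ℝ :=
  P.q x + u.ofLp ⬝ᵥ (P.R *ᵥ u.ofLp)

/-- `(x, u)` is an admissible state-control pair from `x₀` on `[0, ∞)`: `u` is a measurable control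
with values in `U`, and `x` is an absolutely continuous solution of `ẋ = f(x, u)`, `x(0) = x₀`
(written as an integral equation). -/
structure IsAdmissible (x₀ : EuclideanSpace ℝ (Fin n)) (x : ℝ → EuclideanSpace ℝ (Fin n))
    (u : ℝ → EuclideanSpace ℝ (Fin m)) : Prop where
  control_aemeasurable : AEMeasurable u (volume.restrict (Ici (0 : ℝ)))
  control_mem : ∀ t, 0 ≤ t → u t ∈ P.controlSet
  state_continuousOn : ContinuousOn x (Ici 0)
  intervalIntegrable : ∀ t, 0 ≤ t →
    IntervalIntegrable (fun s => P.f (x s) (u s)) volume 0 t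
  state_eq : ∀ t, 0 ≤ t → x t = x₀ + ∫ s in (0 : ℝ)..t, P.f (x s) (u s)

/-- The cost `J = ∫₀^∞ L(x, u) dt ∈ [0, ∞]` of a state-control pair (the running cost is
nonnegative). -/
noncomputable def cost (x : ℝ → EuclideanSpace ℝ (Fin n))
    (u : ℝ → EuclideanSpace ℝ (Fin m)) : ℝ≥0∞ :=
  ∫⁻ t in Ici (0 : ℝ), ENNReal.ofReal (P.runningCost (x t) (u t))

/-- `κ : ℝⁿ → U` is an optimal feedback: from every initial state it generates an admissible
closed-loop trajectory of finite cost which is minimal among all admissible pairs. -/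
def IsOptimalFeedback (κ : EuclideanSpace ℝ (Fin n) → EuclideanSpace ℝ (Fin m)) : Prop :=
  (∀ x, κ x ∈ P.controlSet) ∧
  ∀ x₀, ∃ x : ℝ → EuclideanSpace ℝ (Fin n),
    P.IsAdmissible x₀ x (fun t => κ (x t)) ∧
    P.cost x (fun t => κ (x t)) < (⊤ : ℝ≥0∞) ∧
    ∀ (y : ℝ → EuclideanSpace ℝ (Fin n)) (v : ℝ → EuclideanSpace ℝ (Fin m)),
      P.IsAdmissible x₀ y v → P.cost x (fun t => κ (x t)) ≤ P.cost y v

/-- The closed-loop vector field `x ↦ f(x, κ(x))` of a feedback `κ`. -/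
def closedLoop (κ : EuclideanSpace ℝ (Fin n) → EuclideanSpace ℝ (Fin m)) :
    EuclideanSpace ℝ (Fin n) → EuclideanSpace ℝ (Fin n) :=
  fun x => P.f x (κ x)

/-- `Lu` is a Lipschitz constant of `f` with respect to the control, uniformly over states in the
closed ball of radius `r`. -/
def IsControlLipschitz (r Lu : ℝ) : Prop :=
  ∀ x ∈ Metric.closedBall (0 : EuclideanSpace ℝ (Fin n)) r,
    ∀ u ∈ P.controlSet, ∀ v ∈ P.controlSet, ‖P.f x u - P.f x v‖ ≤ Lu * ‖u - v‖

end OptimalControlProblem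

/-- The Jacobian of `F` exists and is Lipschitz throughout the closed ball of radius `r` (at
boundary points the derivative is taken within the closed ball). -/
def HasLipschitzJacobian {n : ℕ} (F : EuclideanSpace ℝ (Fin n) → EuclideanSpace ℝ (Fin n))
    (r : ℝ) : Prop :=
  DifferentiableOn ℝ F (Metric.closedBall 0 r) ∧
  ∃ L : ℝ≥0, LipschitzOnWith L
    (fun x => fderivWithin ℝ F (Metric.closedBall 0 r) x) (Metric.closedBall 0 r)

/-- The origin is an exponentially stable equilibrium of `ẋ = F(x)`. The bound is imposed on
solutions on every interval `[0, S)`, hence also on those on `[0, ∞)`. -/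
def IsExponentiallyStableAtZero {n : ℕ}
    (F : EuclideanSpace ℝ (Fin n) → EuclideanSpace ℝ (Fin n)) : Prop :=
  F 0 = 0 ∧
  ∃ c k l : ℝ, 0 < c ∧ 0 < k ∧ 0 < l ∧
    ∀ (S : ℝ) (x : ℝ → EuclideanSpace ℝ (Fin n)), 0 < S →
      IsIntegralCurveOn x (fun _ => F) (Ico 0 S) → ‖x 0‖ < c →
      ∀ t ∈ Ico 0 S, ‖x t‖ ≤ k * ‖x 0‖ * Real.exp (-l * t)

/-- `W` is a `C¹` Lyapunov function of quadratic type for `ẋ = F(x)` on the open ball of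
radius `ρ`, with constants `k₁, k₂, k₃, k₄ > 0`. -/
structure IsQuadraticLyapunov {n : ℕ}
    (F : EuclideanSpace ℝ (Fin n) → EuclideanSpace ℝ (Fin n)) (ρ : ℝ)
    (W : EuclideanSpace ℝ (Fin n) → ℝ) (k₁ k₂ k₃ k₄ : ℝ) : Prop where
  k₁_pos : 0 < k₁
  k₂_pos : 0 < k₂
  k₃_pos : 0 < k₃
  k₄_pos : 0 < k₄
  contDiffOn : ContDiffOn ℝ 1 W (Metric.ball 0 ρ)
  lower : ∀ x ∈ Metric.ball 0 ρ, k₁ * ‖x‖ ^ 2 ≤ W x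
  upper : ∀ x ∈ Metric.ball 0 ρ, W x ≤ k₂ * ‖x‖ ^ 2
  decrease : ∀ x ∈ Metric.ball 0 ρ, fderiv ℝ W x (F x) ≤ -k₃ * ‖x‖ ^ 2
  gradient : ∀ x ∈ Metric.ball 0 ρ, ‖fderiv ℝ W x‖ ≤ k₄ * ‖x‖

/-- The maximum control approximation error `max_{‖x‖ ≤ r} ‖κ(x) - κ'(x)‖` (a supremum; for
feedbacks with values in a bounded set the set of errors is bounded). -/
noncomputable def maxControlError {n m : ℕ} (r : ℝ)
    (κ κ' : EuclideanSpace ℝ (Fin n) → EuclideanSpace ℝ (Fin m)) : ℝ :=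
  sSup ((fun x => ‖κ x - κ' x‖) '' Metric.closedBall 0 r)

/-!
The Lyapunov function comes from the linearization. The Lipschitz Jacobian gives
`F x = A x + O(‖x‖²)` for the optimal closed loop `F`, and the trajectories provided by the optimal
feedback are integral curves of `F` as long as they stay in the ball where `F` is differentiable;
exponential stability keeps them there. Over a time `T` after which these trajectories have
contracted by a factor four, Grönwall's inequality bounds their distance from the linear flow by
`O(‖x₀‖²)`, so that `‖exp(TA)‖ ≤ 1/2` (`exists_norm_exp_le_half`). Hence
`W x = ⟪Q x, x⟫` with `Q = ∫₀ᵀ exp(tA)ᵀ exp(tA) dt` satisfies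
`2 ⟪Q x, A x⟫ = ‖exp(TA) x‖² - ‖x‖² ≤ -(3/4) ‖x‖²`, and the quadratic remainder of `F` is harmless
on a small ball (`exists_isQuadraticLyapunov`).

For the perturbed loop, let `μ = Lu k₄ δ / (θ k₃)`. Along its integral curves,
`dW/dt ≤ -k₃ ‖x‖² + k₄ Lu δ ‖x‖ ≤ -(1 - θ) (k₃ / k₂) W` wherever `‖x‖ ≥ μ`. A comparison argument
(`le_max_exp_of_deriv_le`) gives `‖x t‖ ≤ √(k₂/k₁) max (‖x₀‖ e^{-αt}) μ`, with a right-hand side that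
does not depend on the curve. The time `T` at which `‖x₀‖ e^{-αt}` crosses `μ` therefore serves all
solutions at once, although these need not be unique. The assumptions on `δ` and `x₀` say exactly
that the bound keeps the curve inside the ball of radius `ρ`.

The perturbed field is only continuous, so existence of solutions is Peano's theorem, proved here
from Euler polygons and the Arzelà–Ascoli theorem for a bounded uniformly continuous field
(`exists_integralCurveOn_Ici`). It is applied to the perturbed field multiplied by a bump function
that equals `1` on the ball of radius `ρ`; the Lyapunov bound applies to the modified field
too, so that its curves never see the modification.
-/

/-! ### A comparison principle and the invariance of sublevel sets -/

/-- If `w` decays at rate `c` whenever it exceeds `β`, then it stays below the larger of the decaying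
exponential and `β`. After the last time at which `w` is below this barrier, `w s * exp (c * s)`
is nonincreasing, while the barrier times `exp (c * s)` is nondecreasing. -/
theorem le_max_exp_of_deriv_le {w w' : ℝ → ℝ} {a c β t : ℝ} (ht : 0 ≤ t)
    (hw : ContinuousOn w (Icc 0 t)) (hw' : ∀ s ∈ Ioo 0 t, HasDerivAt w (w' s) s)
    (hdec : ∀ s ∈ Ioo 0 t, β < w s → w' s ≤ -c * w s) (hc : 0 ≤ c) (hβ : 0 ≤ β)
    (h0 : w 0 ≤ a) : w t ≤ max (a * Real.exp (-c * t)) β := by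
  by_contra! hlt
  set A : Set ℝ := {s ∈ Icc 0 t | w s ≤ max (a * Real.exp (-c * s)) β} with hA
  have hAc : IsClosed A := by
    refine IsClosed.isClosed_le isClosed_Icc hw ?_
    exact Continuous.continuousOn (by fun_prop)
  have hAk : IsCompact A := isCompact_Icc.of_isClosed_subset hAc (fun s hs => hs.1)
  have hAn : A.Nonempty := ⟨0, ⟨le_rfl, ht⟩, by simp [h0]⟩
  obtain ⟨s₀, ⟨⟨hs0, hst⟩, hws⟩, hmax⟩ := hAk.exists_isGreatest hAn
  have hst' : s₀ < t := by
    rcases hst.lt_or_eq with h | h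
    · exact h
    · subst h; exact absurd hws (not_le.2 hlt)
  have hbig : ∀ s ∈ Ioo s₀ t, β < w s := by
    intro s hs
    by_contra! h
    exact absurd (hmax ⟨⟨hs0.trans hs.1.le, hs.2.le⟩, h.trans (le_max_right _ _)⟩)
      (not_le.2 hs.1)
  have hder : ∀ s ∈ Ioo s₀ t, HasDerivAt (fun s => w s * Real.exp (c * s))
      (w' s * Real.exp (c * s) + w s * (Real.exp (c * s) * c)) s := by
    intro s hs
    have h1 := hw' s ⟨hs0.trans_lt hs.1, hs.2⟩
    have h2 : HasDerivAt (fun s => Real.exp (c * s)) (Real.exp (c * s) * c) s := by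
      simpa using ((hasDerivAt_id s).const_mul c).exp
    exact h1.mul h2
  have hanti : AntitoneOn (fun s => w s * Real.exp (c * s)) (Icc s₀ t) := by
    refine antitoneOn_of_deriv_nonpos (convex_Icc _ _) ?_ ?_ ?_
    · exact (hw.mono (Icc_subset_Icc_left hs0)).mul (Continuous.continuousOn (by fun_prop))
    · rw [interior_Icc]
      exact fun s hs => (hder s hs).differentiableAt.differentiableWithinAt
    · rw [interior_Icc]
      intro s hs
      rw [(hder s hs).deriv]
      have h1 := hdec s ⟨hs0.trans_lt hs.1, hs.2⟩ (hbig s hs)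
      have h2 := Real.exp_pos (c * s)
      nlinarith
  have hfin : w t * Real.exp (c * t) ≤ w s₀ * Real.exp (c * s₀) :=
    hanti ⟨le_rfl, hst⟩ ⟨hst, le_rfl⟩ hst
  have e1 : Real.exp (-c * t) * Real.exp (c * t) = 1 := by
    rw [← Real.exp_add]; simp
  have e2 : Real.exp (-c * s₀) * Real.exp (c * s₀) = 1 := by
    rw [← Real.exp_add]; simp
  have hmono : Real.exp (c * s₀) ≤ Real.exp (c * t) := by
    apply Real.exp_le_exp.2; nlinarith
  have p1 := Real.exp_pos (c * t)
  have p2 := Real.exp_pos (c * s₀)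
  have hw1 := (le_max_left _ _).trans_lt hlt
  have hw2 := (le_max_right _ _).trans_lt hlt
  rcases le_max_iff.1 hws with h | h
  · have h3 := mul_le_mul_of_nonneg_right h p2.le
    have h4 := mul_lt_mul_of_pos_right hw1 p1
    rw [mul_assoc, e2] at h3
    rw [mul_assoc, e1] at h4
    linarith
  · have h3 := mul_le_mul_of_nonneg_right h p2.le
    have h4 := mul_lt_mul_of_pos_right hw2 p1
    have h5 := mul_le_mul_of_nonneg_left hmono hβ
    linarith

/-- A quadratic Lyapunov function for `F` controls the integral curves of every vector field `G`
that differs from `F` by at most `ε`: outside the ball of radius `μ = k₄ ε / (θ k₃)` the function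
still decays exponentially. If `k₂ μ² < k₁ ρ²`, a curve starting with `k₂ ‖x 0‖² < k₁ ρ²` therefore
keeps `W` below `k₁ ρ²` and never reaches the boundary of the ball of radius `ρ`. -/
theorem IsQuadraticLyapunov.integralCurve_bound {n : ℕ}
    {F G : EuclideanSpace ℝ (Fin n) → EuclideanSpace ℝ (Fin n)} {ρ : ℝ}
    {W : EuclideanSpace ℝ (Fin n) → ℝ} {k₁ k₂ k₃ k₄ ε θ μ S : ℝ}
    (hW : IsQuadraticLyapunov F ρ W k₁ k₂ k₃ k₄) (hρ : 0 < ρ)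
    (hG : ∀ x ∈ Metric.ball 0 ρ, ‖G x - F x‖ ≤ ε) (hθ : 0 < θ) (hθ1 : θ < 1)
    (hμ0 : 0 ≤ μ) (hμε : k₄ * ε = θ * k₃ * μ) (hμ : k₂ * μ ^ 2 < k₁ * ρ ^ 2)
    {x : ℝ → EuclideanSpace ℝ (Fin n)} (hx : IsIntegralCurveOn x (fun _ => G) (Ico 0 S))
    (hx0 : k₂ * ‖x 0‖ ^ 2 < k₁ * ρ ^ 2) (hx0' : x 0 ∈ Metric.ball 0 ρ)
    {t : ℝ} (ht : t ∈ Ico 0 S) :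
    x t ∈ Metric.ball 0 ρ ∧
      k₁ * ‖x t‖ ^ 2 ≤
        max (k₂ * ‖x 0‖ ^ 2 * Real.exp (-((1 - θ) * k₃ / k₂) * t)) (k₂ * μ ^ 2) := by
  have hk1 := hW.k₁_pos
  have hk2 := hW.k₂_pos
  have hk3 := hW.k₃_pos
  have hk4 := hW.k₄_pos
  set c := (1 - θ) * k₃ / k₂ with hc
  have hc0 : 0 ≤ c := by
    have : 0 < 1 - θ := by linarith
    positivity
  have hxc : ContinuousOn x (Ico 0 S) := hx.continuousOn
  have hWc := hW.contDiffOn.continuousOn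
  -- the bound on the Lyapunov function up to a time before which the curve stays in the ball
  have key : ∀ t ∈ Ico 0 S, (∀ s ∈ Icc 0 t, x s ∈ Metric.ball 0 ρ) →
      W (x t) ≤ max (k₂ * ‖x 0‖ ^ 2 * Real.exp (-c * t)) (k₂ * μ ^ 2) := by
    intro t ht hball
    have hsub : Icc 0 t ⊆ Ico 0 S := fun s hs => ⟨hs.1, hs.2.trans_lt ht.2⟩
    refine le_max_exp_of_deriv_le (w := fun s => W (x s))
      (w' := fun s => fderiv ℝ W (x s) (G (x s))) ht.1
      (hWc.comp (hxc.mono hsub) hball) ?_ ?_ hc0 (by positivity) (hW.upper _ hx0')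
    · intro s hs
      have hb := hball s ⟨hs.1.le, hs.2.le⟩
      have h1 : HasFDerivAt W (fderiv ℝ W (x s)) (x s) :=
        ((hW.contDiffOn.contDiffAt (Metric.isOpen_ball.mem_nhds hb)).differentiableAt
          one_ne_zero).hasFDerivAt
      have h2 : HasDerivAt x (G (x s)) s :=
        (hx s (hsub ⟨hs.1.le, hs.2.le⟩)).hasDerivAt (Ico_mem_nhds hs.1 (hs.2.trans ht.2))
      exact h1.comp_hasDerivAt s h2
    · intro s hs hlt
      have hb := hball s ⟨hs.1.le, hs.2.le⟩
      have hup := hW.upper _ hb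
      have hn : μ ≤ ‖x s‖ := by
        by_contra! h
        have : ‖x s‖ ^ 2 ≤ μ ^ 2 := by
          have := norm_nonneg (x s)
          nlinarith
        have := mul_le_mul_of_nonneg_left this hk2.le
        linarith
      have hsplit : fderiv ℝ W (x s) (G (x s)) =
          fderiv ℝ W (x s) (F (x s)) + fderiv ℝ W (x s) (G (x s) - F (x s)) := by
        rw [map_sub]; ring
      have h1 := hW.decrease _ hb
      have h2 : fderiv ℝ W (x s) (G (x s) - F (x s)) ≤ k₄ * ‖x s‖ * ε := by
        refine (le_abs_self _).trans ?_
        rw [← Real.norm_eq_abs]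
        refine (ContinuousLinearMap.le_opNorm _ _).trans ?_
        exact mul_le_mul (hW.gradient _ hb) (hG _ hb) (norm_nonneg _) (by positivity)
      have h3 : c * W (x s) ≤ (1 - θ) * k₃ * ‖x s‖ ^ 2 := by
        have : c * W (x s) ≤ c * (k₂ * ‖x s‖ ^ 2) := mul_le_mul_of_nonneg_left hup hc0
        refine this.trans_eq ?_
        rw [hc]; field_simp
      have h4 : k₄ * ‖x s‖ * ε ≤ θ * k₃ * ‖x s‖ ^ 2 := by
        have : k₄ * ‖x s‖ * ε = θ * k₃ * μ * ‖x s‖ := by rw [← hμε]; ring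
        rw [this]
        have : θ * k₃ * ‖x s‖ * μ ≤ θ * k₃ * ‖x s‖ * ‖x s‖ :=
          mul_le_mul_of_nonneg_left hn (by positivity)
        nlinarith
      simp only [hsplit]
      nlinarith
  have hbound : ∀ t ∈ Ico 0 S, (∀ s ∈ Icc 0 t, x s ∈ Metric.ball 0 ρ) →
      k₁ * ‖x t‖ ^ 2 ≤ max (k₂ * ‖x 0‖ ^ 2) (k₂ * μ ^ 2) := by
    intro t ht hball
    refine (hW.lower _ (hball t ⟨ht.1, le_rfl⟩)).trans ((key t ht hball).trans ?_)
    refine max_le_max_right _ (mul_le_of_le_one_right (by positivity) ?_)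
    exact Real.exp_le_one_iff.2 (by nlinarith [ht.1])
  -- the curve cannot leave the ball: consider the first exit time
  have hstay : ∀ t ∈ Ico 0 S, x t ∈ Metric.ball 0 ρ := by
    by_contra! hcon
    obtain ⟨t₁, ht₁, hout⟩ := hcon
    have hsub : Icc 0 t₁ ⊆ Ico 0 S := fun s hs => ⟨hs.1, hs.2.trans_lt ht₁.2⟩
    set A : Set ℝ := {s ∈ Icc 0 t₁ | ρ ≤ ‖x s‖} with hA
    have hAc : IsClosed A :=
      IsClosed.isClosed_le isClosed_Icc continuousOn_const (hxc.mono hsub).norm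
    have hAk : IsCompact A := isCompact_Icc.of_isClosed_subset hAc (fun s hs => hs.1)
    have hAn : A.Nonempty := ⟨t₁, ⟨ht₁.1, le_rfl⟩, by simpa using hout⟩
    obtain ⟨τ, ⟨⟨hτ0, hτt⟩, hτ⟩, hmin⟩ := hAk.exists_isLeast hAn
    have hτpos : 0 < τ := by
      rcases hτ0.lt_or_eq with h | h
      · exact h
      · subst h
        simp only [mem_ball_zero_iff] at hx0'
        linarith
    have hin : ∀ s ∈ Ico 0 τ, x s ∈ Metric.ball 0 ρ := by
      intro s hs
      rw [mem_ball_zero_iff]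
      by_contra! h
      exact absurd (hmin ⟨⟨hs.1, hs.2.le.trans hτt⟩, h⟩) (not_le.2 hs.2)
    have hlim : k₁ * ‖x τ‖ ^ 2 ≤ max (k₂ * ‖x 0‖ ^ 2) (k₂ * μ ^ 2) := by
      have hcw : ContinuousWithinAt (fun s => k₁ * ‖x s‖ ^ 2) (Ico 0 τ) τ := by
        have := (hxc τ (hsub ⟨hτ0, hτt⟩)).mono
          (show Ico 0 τ ⊆ Ico 0 S from Ico_subset_Ico_right (hτt.trans ht₁.2.le))
        exact (this.norm.pow 2).const_mul k₁
      refine hcw.closure_le ?_ continuousWithinAt_const ?_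
      · rw [closure_Ico hτpos.ne]; exact ⟨hτ0, le_rfl⟩
      · intro s hs
        exact hbound s ⟨hs.1, hs.2.trans_le (hτt.trans ht₁.2.le)⟩
          (fun u hu => hin u ⟨hu.1, hu.2.trans_lt hs.2⟩)
    have : k₁ * ρ ^ 2 ≤ k₁ * ‖x τ‖ ^ 2 := by gcongr
    exact absurd (this.trans hlim) (not_le.2 (max_lt hx0 hμ))
  have hst := fun s (hs : s ∈ Icc 0 t) => hstay s ⟨hs.1, hs.2.trans_lt ht.2⟩
  exact ⟨hstay t ht, (hW.lower _ (hstay t ht)).trans (key t ht hst)⟩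

/-! ### Existence and continuation of integral curves of continuous vector fields -/

/-- The integral curve equation in integrated form, with an error growing at rate `η`, has a solution
that is moreover `M`-Lipschitz: the Euler polygon of small step size. -/
theorem exists_lipschitzWith_approx_integralCurve {E : Type*} [NormedAddCommGroup E]
    [NormedSpace ℝ E] [CompleteSpace E] {G : E → E} (hG : UniformContinuous G) {M : ℝ≥0}
    (hM : ∀ x, ‖G x‖ ≤ M) (x₀ : E) {η : ℝ} (hη : 0 < η) :
    ∃ x : ℝ → E, x 0 = x₀ ∧ LipschitzWith M x ∧
      ∀ t, 0 ≤ t → ‖x t - x₀ - ∫ s in (0 : ℝ)..t, G (x s)‖ ≤ η * t := by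
  obtain ⟨δ, hδ, hGδ⟩ := Metric.uniformContinuous_iff.1 hG η hη
  obtain ⟨h, hh, hMh⟩ : ∃ h : ℝ, 0 < h ∧ M * h < δ := by
    refine ⟨δ / (M + 1), by positivity, ?_⟩
    have : (M : ℝ) / (M + 1) < 1 := by
      rw [div_lt_one (by positivity)]; linarith
    calc (M : ℝ) * (δ / (M + 1)) = M / (M + 1) * δ := by ring
      _ < 1 * δ := by gcongr
      _ = δ := one_mul δ
  set y : ℕ → E := fun k => (fun z => z + h • G z)^[k] x₀ with hy
  have hy1 : ∀ k, y (k + 1) = y k + h • G (y k) := fun k => by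
    simp only [hy, Function.iterate_succ_apply']
  set v : ℝ → E := fun s => G (y (⌈s / h⌉₊ - 1)) with hv
  have hvm : StronglyMeasurable v :=
    (StronglyMeasurable.of_discrete (f := fun k : ℕ => G (y (k - 1)))).comp_measurable
      (Nat.measurable_ceil.comp (measurable_id.div_const h))
  have hvi : ∀ a b, IntervalIntegrable v volume a b := fun a b =>
    (intervalIntegrable_const (c := (M : ℝ))).mono_fun hvm.aestronglyMeasurable
      (.of_forall fun s => by simpa using hM _)
  set x : ℝ → E := fun t => x₀ + ∫ s in (0 : ℝ)..t, v s with hx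
  have hsub : ∀ a b, x b - x a = ∫ s in a..b, v s := fun a b => by
    simp only [hx]
    rw [add_sub_add_left_eq_sub, intervalIntegral.integral_interval_sub_left (hvi _ _) (hvi _ _)]
  have hlip : LipschitzWith M x := by
    refine LipschitzWith.of_dist_le_mul fun b a => ?_
    rw [dist_eq_norm, hsub, Real.dist_eq]
    exact intervalIntegral.norm_integral_le_of_norm_le_const fun s _ => hM _
  have hxy : ∀ k : ℕ, x (k * h) = y k := by
    intro k
    induction k with
    | zero => simp [hx, hy]
    | succ k ih =>
      have h1 : ∫ s in (k * h)..((k + 1 : ℕ) * h), v s = ∫ s in (k * h)..((k + 1 : ℕ) * h),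
          G (y k) := by
        refine intervalIntegral.integral_congr_ae (.of_forall fun s hs => ?_)
        rw [uIoc_of_le (by push_cast; nlinarith)] at hs
        have : ⌈s / h⌉₊ = k + 1 := by
          rw [Nat.ceil_eq_iff (by simp)]
          rw [lt_div_iff₀ hh, div_le_iff₀ hh]
          simpa using hs
        simp [hv, this]
      have h2 := hsub (k * h) ((k + 1 : ℕ) * h)
      rw [h1, intervalIntegral.integral_const, ih] at h2
      rw [hy1, ← sub_eq_iff_eq_add', h2]
      congr 1
      push_cast; ring
  refine ⟨x, by simp [hx], hlip, fun t ht => ?_⟩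
  have hGx : IntervalIntegrable (fun s => G (x s)) volume 0 t :=
    (hG.continuous.comp hlip.continuous).intervalIntegrable _ _
  have h1 : x t - x₀ - ∫ s in (0 : ℝ)..t, G (x s) = ∫ s in (0 : ℝ)..t, (v s - G (x s)) := by
    rw [intervalIntegral.integral_sub (hvi _ _) hGx]
    simp [hx]
  rw [h1]
  refine (intervalIntegral.norm_integral_le_of_norm_le_const (C := η) fun s hs => ?_).trans_eq
    (by rw [sub_zero, abs_of_nonneg ht])
  rw [uIoc_of_le ht] at hs
  obtain ⟨k, hk⟩ : ∃ k, ⌈s / h⌉₊ = k + 1 :=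
    Nat.exists_eq_succ_of_ne_zero (Nat.ceil_pos.2 (div_pos hs.1 hh)).ne'
  have hks := (Nat.ceil_eq_iff (by simp)).1 hk
  rw [lt_div_iff₀ hh, div_le_iff₀ hh] at hks
  simp only [Nat.add_sub_cancel, Nat.cast_add, Nat.cast_one] at hks
  have h2 : v s = G (x (k * h)) := by simp [hv, hk, hxy]
  rw [h2, ← dist_eq_norm]
  refine (hGδ ?_).le
  refine (hlip.dist_le_mul _ _).trans_lt (lt_of_le_of_lt ?_ hMh)
  gcongr
  rw [Real.dist_eq, abs_le]
  constructor <;> linarith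

/-- **Peano's theorem**, global version for a bounded field: among the curves that are `M`-Lipschitz
and start at `x₀`, a compact set for locally uniform convergence, those that solve the integral
equation up to an error `t / (j + 1)` form a decreasing sequence of nonempty closed sets. -/
theorem exists_integralCurveOn_Ici {E : Type*} [NormedAddCommGroup E]
    [NormedSpace ℝ E] [FiniteDimensional ℝ E] {G : E → E} (hG : UniformContinuous G) {M : ℝ≥0}
    (hM : ∀ x, ‖G x‖ ≤ M) (x₀ : E) :
    ∃ x : ℝ → E, x 0 = x₀ ∧ IsIntegralCurveOn x (fun _ => G) (Ici 0) := by
  have : ProperSpace E := FiniteDimensional.proper ℝ E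
  set A : Set C(ℝ, E) := {x | x 0 = x₀ ∧ LipschitzWith M x} with hA
  have hAk : IsCompact A := by
    refine ArzelaAscoli.isCompact_of_equicontinuous A ?_ ?_
    · have himg : ContinuousMap.toFun '' A = {x : ℝ → E | x 0 = x₀ ∧ LipschitzWith M x} := by
        ext x
        constructor
        · rintro ⟨z, hz, rfl⟩; exact hz
        · rintro hx; exact ⟨⟨x, hx.2.continuous⟩, hx, rfl⟩
      rw [himg]
      refine (isCompact_univ_pi fun t : ℝ => isCompact_closedBall x₀ (M * |t|)).of_isClosed_subset
        ?_ ?_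
      · refine (isClosed_eq (continuous_apply 0) continuous_const).inter ?_
        have : {x : ℝ → E | LipschitzWith M x} =
            ⋂ (a : ℝ) (b : ℝ), {x | dist (x a) (x b) ≤ M * dist a b} := by
          ext x; simp [lipschitzWith_iff_dist_le_mul]
        change IsClosed {x : ℝ → E | LipschitzWith M x}
        rw [this]
        exact isClosed_iInter fun a => isClosed_iInter fun b =>
          isClosed_le ((continuous_apply a).dist (continuous_apply b)) continuous_const
      · rintro x ⟨hx0, hx⟩ t -
        have := hx.dist_le_mul t 0
        rwa [hx0, Real.dist_eq, sub_zero] at this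
    · exact (LipschitzWith.uniformEquicontinuous (fun x : A => (x : C(ℝ, E))) M
        (fun x => x.2.2)).equicontinuous
  have hcontI : ∀ t : ℝ, Continuous fun x : C(ℝ, E) => ∫ s in (0 : ℝ)..t, G (x s) := fun t =>
    intervalIntegral.continuous_parametric_intervalIntegral_of_continuous'
      (f := fun (x : C(ℝ, E)) s => G (x s)) (hG.continuous.comp (by fun_prop)) 0 t
  set K : ℕ → Set C(ℝ, E) := fun j => A ∩ ⋂ (t : ℝ) (_ : 0 ≤ t),
    {x | ‖x t - x₀ - ∫ s in (0 : ℝ)..t, G (x s)‖ ≤ 1 / ((j : ℝ) + 1) * t} with hK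
  have hKc : ∀ j, IsClosed (K j) := fun j => by
    refine hAk.isClosed.inter (isClosed_iInter fun t => isClosed_iInter fun _ => ?_)
    refine isClosed_le (Continuous.norm (Continuous.sub ?_ (hcontI t))) continuous_const
    exact (ContinuousEvalConst.continuous_eval_const t).sub continuous_const
  obtain ⟨x, hx⟩ := IsCompact.nonempty_iInter_of_sequence_nonempty_isCompact_isClosed K
    (by
      intro j x hx
      refine ⟨hx.1, ?_⟩
      have hx2 := hx.2
      simp only [mem_iInter, mem_ofPred_eq] at hx2 ⊢
      intro t ht
      refine (hx2 t ht).trans (mul_le_mul_of_nonneg_right ?_ ht)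
      exact one_div_le_one_div_of_le (by positivity) (by push_cast; linarith))
    (by
      intro j
      obtain ⟨x, hx0, hxl, hxe⟩ := exists_lipschitzWith_approx_integralCurve hG hM x₀
        (η := 1 / ((j : ℝ) + 1)) (by positivity)
      exact ⟨⟨x, hxl.continuous⟩, ⟨hx0, hxl⟩, by simpa using hxe⟩)
    (hAk.of_isClosed_subset (hKc 0) inter_subset_left) hKc
  rw [mem_iInter] at hx
  have hsol : ∀ t, 0 ≤ t → x t = x₀ + ∫ s in (0 : ℝ)..t, G (x s) := by
    intro t ht
    have h1 : ∀ j : ℕ, ‖x t - x₀ - ∫ s in (0 : ℝ)..t, G (x s)‖ ≤ 1 / ((j : ℝ) + 1) * t := by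
      intro j
      have := (hx j).2
      simp only [mem_iInter, mem_ofPred_eq] at this
      exact this t ht
    have h2 : Filter.Tendsto (fun j : ℕ => 1 / ((j : ℝ) + 1) * t) Filter.atTop (nhds 0) := by
      simpa using (tendsto_one_div_add_atTop_nhds_zero_nat (𝕜 := ℝ)).mul_const t
    have h3 := ge_of_tendsto' h2 h1
    have h4 := norm_le_zero_iff.1 h3
    rw [sub_sub, sub_eq_zero] at h4
    exact h4
  refine ⟨x, (hx 0).1.1, fun t ht => ?_⟩
  have hd : HasDerivAt (fun t => x₀ + ∫ s in (0 : ℝ)..t, G (x s)) (G (x t)) t :=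
    ((hG.continuous.comp x.continuous).integral_hasStrictDerivAt 0 t).hasDerivAt.const_add x₀
  exact hd.hasDerivWithinAt.congr (fun s hs => hsol s hs) (hsol t ht)

open scoped Pointwise in
/-- An integral curve of a bounded vector field on `[0, S)` has a limit at `S`, from which it can be
continued. -/
theorem IsIntegralCurveOn.exists_extension {E : Type*} [NormedAddCommGroup E]
    [NormedSpace ℝ E] [FiniteDimensional ℝ E] {G : E → E} (hG : Continuous G) {M : ℝ≥0}
    (hM : ∀ x, ‖G x‖ ≤ M)
    (hex : ∀ p, ∃ z : ℝ → E, z 0 = p ∧ IsIntegralCurveOn z (fun _ => G) (Ici 0))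
    {S : ℝ} (hS : 0 < S) {x : ℝ → E} (hx : IsIntegralCurveOn x (fun _ => G) (Ico 0 S)) :
    ∃ y : ℝ → E, EqOn y x (Ico 0 S) ∧ IsIntegralCurveOn y (fun _ => G) (Ici 0) := by
  have hlip : LipschitzOnWith M x (Ico 0 S) :=
    (convex_Ico 0 S).lipschitzOnWith_of_nnnorm_hasDerivWithin_le hx fun t _ => hM (x t)
  obtain ⟨g, hg, hxg⟩ := hlip.extend_finite_dimension
  obtain ⟨z, hz0, hz⟩ := hex (g S)
  set y : ℝ → E := fun t => if t < S then g t else z (t - S) with hy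
  have hyx : EqOn y x (Ico 0 S) := fun t ht => by simp [hy, ht.2, hxg ht]
  have hyS : y S = g S := by simp [hy, hz0]
  have hyg : EqOn y g (Iic S) := fun t ht => by
    rcases (mem_Iic.1 ht).lt_or_eq with h | h
    · simp [hy, h]
    · rw [h, hyS]
  have hyz : EqOn y (fun t => z (t - S)) (Ici S) := fun t ht => by
    simp [hy, not_lt.2 (mem_Ici.1 ht)]
  have hset : S +ᵥ Ici (0 : ℝ) = Ici S := by
    ext u
    simp [mem_vadd_set_iff_neg_vadd_mem]
  have hzS : ∀ t ∈ Ici S, HasDerivWithinAt y (G (y t)) (Ici S) t := by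
    intro t ht
    have h1 := hz.comp_sub S
    rw [hset] at h1
    rw [hyz ht]
    exact (h1 t ht).congr hyz (hyz ht)
  refine ⟨y, hyx, fun t ht => ?_⟩
  rcases lt_trichotomy t S with h | h | h
  · have h1 := hx t ⟨ht, h⟩
    have hmem : Ico 0 S ∈ nhdsWithin t (Ici 0) :=
      inter_mem_nhdsWithin (Ici (0 : ℝ)) (Iio_mem_nhds h)
    have h2 : HasDerivWithinAt x (G (x t)) (Ici 0) t := h1.mono_of_mem_nhdsWithin hmem
    rw [hyx ⟨ht, h⟩]
    refine h2.congr_of_eventuallyEq ?_ (hyx ⟨ht, h⟩)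
    filter_upwards [hmem] with u hu
    exact hyx hu
  · subst h
    have hder : ∀ s ∈ Ioo 0 t, HasDerivAt y (G (y s)) s := by
      intro s hs
      have h1 := (hx s ⟨hs.1.le, hs.2⟩).hasDerivAt (Ico_mem_nhds hs.1 hs.2)
      rw [hyx ⟨hs.1.le, hs.2⟩]
      refine h1.congr_of_eventuallyEq ?_
      filter_upwards [Ico_mem_nhds hs.1 hs.2] with u hu
      exact hyx hu
    have hcw : ContinuousWithinAt y (Iic t) t :=
      hg.continuous.continuousWithinAt.congr hyg hyS
    have hleft : HasDerivWithinAt y (G (y t)) (Iic t) t := by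
      refine hasDerivWithinAt_Iic_of_tendsto_deriv (s := Ioo 0 t)
        (fun s hs => (hder s hs).differentiableAt.differentiableWithinAt)
        (hcw.mono fun s hs => hs.2.le) (Ioo_mem_nhdsLT hS) ?_
      have h1 : Filter.Tendsto (fun s => G (y s)) (nhdsWithin t (Iio t)) (nhds (G (y t))) :=
        (hG.tendsto (y t)).comp (hcw.mono Iio_subset_Iic_self)
      refine h1.congr' ?_
      filter_upwards [Ioo_mem_nhdsLT hS] with s hs
      exact (hder s hs).deriv.symm
    have := hleft.union (hzS t self_mem_Ici)
    rw [Iic_union_Ici] at this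
    exact this.mono (subset_univ _)
  · have := (hzS t h.le).hasDerivAt (Ici_mem_nhds h)
    exact this.hasDerivWithinAt

/-! ### A quadratic Lyapunov function from exponential stability -/

theorem HasLipschitzJacobian.exists_norm_sub_le {n : ℕ}
    {F : EuclideanSpace ℝ (Fin n) → EuclideanSpace ℝ (Fin n)} {r : ℝ} (hr : 0 < r)
    (hF : HasLipschitzJacobian F r) (h0 : F 0 = 0) :
    ∃ (A : EuclideanSpace ℝ (Fin n) →L[ℝ] EuclideanSpace ℝ (Fin n)) (L : ℝ), 0 ≤ L ∧
      ∀ x ∈ Metric.closedBall 0 r, ‖F x - A x‖ ≤ L * ‖x‖ ^ 2 := by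
  obtain ⟨hd, L, hL⟩ := hF
  refine ⟨fderivWithin ℝ F (Metric.closedBall 0 r) 0, L, L.2, fun x hx => ?_⟩
  have hsub : Metric.closedBall (0 : EuclideanSpace ℝ (Fin n)) ‖x‖ ⊆ Metric.closedBall 0 r :=
    Metric.closedBall_subset_closedBall (by simpa using hx)
  have := Convex.norm_image_sub_le_of_norm_hasFDerivWithin_le'
    (f := F) (f' := fun y => fderivWithin ℝ F (Metric.closedBall 0 r) y)
    (φ := fderivWithin ℝ F (Metric.closedBall 0 r) 0) (C := L * ‖x‖) (x := 0) (y := x)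
    (fun y hy => (hd y (hsub hy)).hasFDerivWithinAt.mono hsub)
    (fun y hy => by
      have h1 := hL.dist_le_mul y (hsub hy) 0 (Metric.mem_closedBall_self hr.le)
      rw [dist_eq_norm, dist_zero_right] at h1
      refine h1.trans ?_
      gcongr
      simpa using hy)
    (convex_closedBall (0 : EuclideanSpace ℝ (Fin n)) ‖x‖) (by simp) (by simp)
  simp only [h0, sub_zero] at this
  exact this.trans_eq (by ring)

/-- A curve that satisfies the integral equation with an integrand continuous on `[0, S)` is
differentiable on `[0, S)`. -/
theorem hasDerivWithinAt_Ico_of_eq_integral {E : Type*} [NormedAddCommGroup E]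
    [NormedSpace ℝ E] [CompleteSpace E] {h x : ℝ → E} {x₀ : E} {S : ℝ}
    (hh : ContinuousOn h (Ico 0 S))
    (hx : ∀ t ∈ Ico 0 S, x t = x₀ + ∫ s in (0 : ℝ)..t, h s) {t : ℝ} (ht : t ∈ Ico 0 S) :
    HasDerivWithinAt x (h t) (Ico 0 S) t := by
  -- the integrand is replaced by a continuous extension of its restriction to `[0, (t + S) / 2]`
  set b : ℝ := (t + S) / 2 with hb
  have hb1 : t < b := by rw [hb]; linarith [ht.2]
  have hb2 : b < S := by rw [hb]; linarith [ht.2]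
  have hb0 : 0 ≤ b := ht.1.trans hb1.le
  set g : ℝ → E := IccExtend hb0 ((Icc 0 b).domRestrict h) with hg
  have hgc : Continuous g :=
    (continuousOn_iff_continuous_domRestrict.1
      (hh.mono fun s hs => ⟨hs.1, hs.2.trans_lt hb2⟩)).Icc_extend'
  have hgh : ∀ s ∈ Icc 0 b, g s = h s := fun s hs => by
    rw [hg, IccExtend_of_mem _ _ hs]; rfl
  have hxg : ∀ s ∈ Icc 0 b, x s = x₀ + ∫ u in (0 : ℝ)..s, g u := by
    intro s hs
    rw [hx s ⟨hs.1, hs.2.trans_lt hb2⟩]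
    congr 1
    refine intervalIntegral.integral_congr fun u hu => ?_
    rw [uIcc_of_le hs.1] at hu
    exact (hgh u ⟨hu.1, hu.2.trans hs.2⟩).symm
  have hd : HasDerivAt (fun t => x₀ + ∫ s in (0 : ℝ)..t, g s) (g t) t :=
    (hgc.integral_hasStrictDerivAt 0 t).hasDerivAt.const_add x₀
  rw [← hgh t ⟨ht.1, hb1.le⟩]
  refine hd.hasDerivWithinAt.congr_of_eventuallyEq ?_ (hxg t ⟨ht.1, hb1.le⟩)
  filter_upwards [self_mem_nhdsWithin, mem_nhdsWithin_of_mem_nhds (Iio_mem_nhds hb1)] with s h1 h2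
  exact hxg s ⟨h1.1, (mem_Iio.1 h2).le⟩

/-- Near an exponentially stable equilibrium, the closed-loop trajectories provided by an optimal
feedback stay in the region where the closed loop is continuous; they are therefore differentiable
and obey the exponential bound for all times. -/
theorem OptimalControlProblem.IsOptimalFeedback.exists_exponential_curve {n m : ℕ}
    {P : OptimalControlProblem n m}
    {κ : EuclideanSpace ℝ (Fin n) → EuclideanSpace ℝ (Fin m)} (hopt : P.IsOptimalFeedback κ)
    {r : ℝ} (hr : 0 < r) (hc : ContinuousOn (P.closedLoop κ) (Metric.closedBall 0 r))
    (hstab : IsExponentiallyStableAtZero (P.closedLoop κ)) :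
    ∃ d k l : ℝ, 0 < d ∧ 0 < k ∧ 0 < l ∧ ∀ x₀ : EuclideanSpace ℝ (Fin n), ‖x₀‖ < d →
      ∃ x : ℝ → EuclideanSpace ℝ (Fin n), x 0 = x₀ ∧
        ∀ S, IsIntegralCurveOn x (fun _ => P.closedLoop κ) (Ico 0 S) ∧
          ∀ t ∈ Ico 0 S, ‖x t‖ < r ∧ ‖x t‖ ≤ k * ‖x₀‖ * Real.exp (-l * t) := by
  obtain ⟨-, c, k, l, hc0, hk, hl, hsol⟩ := hstab
  refine ⟨min c (min r (r / k)), k, l, by positivity, hk, hl, fun x₀ hx₀ => ?_⟩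
  rw [lt_min_iff, lt_min_iff, lt_div_iff₀ hk] at hx₀
  obtain ⟨x, hx, -⟩ := hopt.2 x₀
  have hx0 : x 0 = x₀ := by simpa using hx.state_eq 0 le_rfl
  have hcurve : ∀ S, (∀ t ∈ Ico 0 S, ‖x t‖ < r) →
      IsIntegralCurveOn x (fun _ => P.closedLoop κ) (Ico 0 S) := by
    intro S hS t ht
    refine hasDerivWithinAt_Ico_of_eq_integral (h := fun s => P.closedLoop κ (x s)) (x₀ := x₀)
      ?_ (fun s hs => hx.state_eq s hs.1) ht
    exact hc.comp (hx.state_continuousOn.mono fun s hs => hs.1)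
      fun s hs => by simpa using (hS s hs).le
  have hstay : ∀ t, 0 ≤ t → ‖x t‖ < r := by
    by_contra! hcon
    obtain ⟨t₁, ht₁, hout⟩ := hcon
    set A : Set ℝ := {s ∈ Icc 0 t₁ | r ≤ ‖x s‖} with hA
    have hAc : IsClosed A := IsClosed.isClosed_le isClosed_Icc continuousOn_const
      (hx.state_continuousOn.mono fun s hs => hs.1).norm
    have hAk : IsCompact A := isCompact_Icc.of_isClosed_subset hAc (fun s hs => hs.1)
    obtain ⟨τ, ⟨⟨hτ0, hτt⟩, hτ⟩, hmin⟩ := hAk.exists_isLeast ⟨t₁, ⟨ht₁, le_rfl⟩, hout⟩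
    have hτpos : 0 < τ := by
      rcases hτ0.lt_or_eq with h | h
      · exact h
      · subst h
        rw [hx0] at hτ
        linarith
    have hin : ∀ s ∈ Ico 0 τ, ‖x s‖ < r := by
      intro s hs
      by_contra! h
      exact absurd (hmin ⟨⟨hs.1, hs.2.le.trans hτt⟩, h⟩) (not_le.2 hs.2)
    have hb := hsol τ x hτpos (hcurve τ hin) (by rw [hx0]; exact hx₀.1)
    have hlim : ‖x τ‖ ≤ k * ‖x₀‖ := by
      have hcw : ContinuousWithinAt (fun s => ‖x s‖) (Ico 0 τ) τ :=
        ((hx.state_continuousOn τ hτ0).mono fun s hs => hs.1).norm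
      refine hcw.closure_le ?_ continuousWithinAt_const ?_
      · rw [closure_Ico hτpos.ne]; exact ⟨hτ0, le_rfl⟩
      · intro s hs
        refine (hb s hs).trans ?_
        rw [hx0]
        refine mul_le_of_le_one_right (by positivity) (Real.exp_le_one_iff.2 ?_)
        nlinarith [hs.1]
    linarith [hx₀.2.2]
  refine ⟨x, hx0, fun S => ⟨hcurve S fun t ht => hstay t ht.1, fun t ht => ⟨hstay t ht.1, ?_⟩⟩⟩
  have := hsol S x (ht.1.trans_lt ht.2) (hcurve S fun t ht => hstay t ht.1)
    (by rw [hx0]; exact hx₀.1) t ht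
  rwa [hx0] at this

/-- Exponential decay of the nonlinear curves passes to the linearization: over a fixed time
interval the two flows started at `x₀` differ by `O(‖x₀‖²)`, by Grönwall's inequality. -/
theorem exists_norm_exp_le_half {E : Type*} [NormedAddCommGroup E] [NormedSpace ℝ E]
    [CompleteSpace E] {F : E → E} {A : E →L[ℝ] E} {L r d k l : ℝ} (hL : 0 ≤ L)
    (hFA : ∀ x ∈ Metric.closedBall 0 r, ‖F x - A x‖ ≤ L * ‖x‖ ^ 2)
    (hd : 0 < d) (hk : 0 < k) (hl : 0 < l)
    (hcurve : ∀ x₀ : E, ‖x₀‖ < d → ∃ x : ℝ → E, x 0 = x₀ ∧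
        ∀ S, IsIntegralCurveOn x (fun _ => F) (Ico 0 S) ∧
          ∀ t ∈ Ico 0 S, ‖x t‖ < r ∧ ‖x t‖ ≤ k * ‖x₀‖ * Real.exp (-l * t)) :
    ∃ T : ℝ, 0 < T ∧ ‖NormedSpace.exp (T • A)‖ ≤ 1 / 2 := by
  set T : ℝ := max 1 (Real.log (4 * k) / l) with hT
  have hT0 : 0 < T := lt_max_of_lt_left one_pos
  have hkT : k * Real.exp (-l * T) ≤ 1 / 4 := by
    have h1 : Real.log (4 * k) ≤ l * T := by
      rw [← div_le_iff₀' hl]; exact le_max_right _ _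
    have h2 : 4 * k ≤ Real.exp (l * T) := by
      rw [← Real.log_le_iff_le_exp (by positivity)]; exact h1
    rw [neg_mul, Real.exp_neg, ← div_eq_mul_inv, div_le_iff₀ (Real.exp_pos _)]
    linarith
  set K : ℝ := ‖A‖ + 1 with hK
  have hK0 : 0 < K := by positivity
  set C : ℝ := L * k ^ 2 / K * (Real.exp (K * T) - 1) with hC
  have hC0 : 0 ≤ C := by
    have : 0 ≤ Real.exp (K * T) - 1 := by
      have := Real.one_le_exp (x := K * T) (by positivity)
      linarith
    positivity
  refine ⟨T, hT0, ?_⟩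
  refine ContinuousLinearMap.opNorm_le_of_ball (ε := min d (1 / (4 * (C + 1)))) (by positivity)
    (by norm_num) fun x₀ hx₀ => ?_
  rw [mem_ball_zero_iff, lt_min_iff] at hx₀
  obtain ⟨x, hx0, hx⟩ := hcurve x₀ hx₀.1
  set y : ℝ → E := fun t => NormedSpace.exp (t • A) x₀ with hy
  have hyd : ∀ t, HasDerivAt y (A (y t)) t := fun t => by
    simpa [hy] using (hasDerivAt_exp_smul_const' (𝕂 := ℝ) A t).clm_apply (hasDerivAt_const t x₀)
  have hyc : Continuous y := continuous_iff_continuousAt.2 fun t => (hyd t).continuousAt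
  obtain ⟨hxc, hxb⟩ := hx (T + 1)
  have hsub : Icc 0 T ⊆ Ico 0 (T + 1) := fun s hs => ⟨hs.1, by linarith [hs.2]⟩
  have hdiff : ‖x T - y T‖ ≤ gronwallBound 0 K (L * k ^ 2 * ‖x₀‖ ^ 2) (T - 0) := by
    refine norm_le_gronwallBound_of_norm_deriv_right_le (f := fun t => x t - y t)
      (f' := fun t => F (x t) - A (y t)) ((hxc.continuousOn.mono hsub).sub hyc.continuousOn)
      ?_ ?_ ?_ T ⟨hT0.le, le_rfl⟩
    · intro t ht
      have h1 : HasDerivWithinAt x (F (x t)) (Ici t) t := by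
        refine (hxc t (hsub ⟨ht.1, ht.2.le⟩)).mono_of_mem_nhdsWithin ?_
        filter_upwards [Ico_mem_nhdsGE ht.2] with s hs
        exact ⟨ht.1.trans hs.1, by linarith [hs.2]⟩
      exact h1.sub (hyd t).hasDerivWithinAt
    · simp [hx0, hy]
    · intro t ht
      obtain ⟨hb1, hb2⟩ := hxb t (hsub ⟨ht.1, ht.2.le⟩)
      have hb3 : ‖x t‖ ≤ k * ‖x₀‖ := by
        refine hb2.trans (mul_le_of_le_one_right (by positivity) (Real.exp_le_one_iff.2 ?_))
        nlinarith [ht.1]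
      have e : F (x t) - A (y t) = A (x t - y t) + (F (x t) - A (x t)) := by
        rw [map_sub]; abel
      rw [e]
      refine (norm_add_le _ _).trans (add_le_add ?_ ?_)
      · refine (A.le_opNorm _).trans ?_
        gcongr
        linarith
      · refine (hFA _ (by simpa using hb1.le)).trans ?_
        calc L * ‖x t‖ ^ 2 ≤ L * (k * ‖x₀‖) ^ 2 := by gcongr
          _ = L * k ^ 2 * ‖x₀‖ ^ 2 := by ring
  have hgr : gronwallBound 0 K (L * k ^ 2 * ‖x₀‖ ^ 2) (T - 0) = C * ‖x₀‖ ^ 2 := by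
    rw [gronwallBound_of_K_ne_0 hK0.ne', sub_zero, hC]
    ring
  rw [hgr] at hdiff
  have hxT : ‖x T‖ ≤ 1 / 4 * ‖x₀‖ := by
    refine (hxb T ⟨hT0.le, by linarith⟩).2.trans ?_
    calc k * ‖x₀‖ * Real.exp (-l * T) = k * Real.exp (-l * T) * ‖x₀‖ := by ring
      _ ≤ _ := by gcongr
  have hCx : C * ‖x₀‖ ≤ 1 / 4 := by
    have h1 := hx₀.2.le
    rw [le_div_iff₀ (by positivity)] at h1
    nlinarith [norm_nonneg x₀]
  have htri : ‖y T‖ ≤ ‖x T‖ + ‖x T - y T‖ := by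
    have := norm_sub_le (x T) (x T - y T)
    rwa [sub_sub_cancel] at this
  change ‖y T‖ ≤ _
  nlinarith [norm_nonneg x₀]

/-- If the flow of a linear field `A` contracts after time `T`, then
`Q = ∫₀ᵀ exp(tA)ᵀ exp(tA) dt` is positive definite and solves the Lyapunov inequality. -/
theorem exists_lyapunov_operator {E : Type*} [NormedAddCommGroup E] [InnerProductSpace ℝ E]
    [CompleteSpace E] {A : E →L[ℝ] E} {T : ℝ} (hT : 0 < T)
    (hA : ‖NormedSpace.exp (T • A)‖ ≤ 1 / 2) :
    ∃ (Q : E →L[ℝ] E) (k : ℝ), 0 < k ∧ (∀ x y, inner ℝ (Q x) y = inner ℝ x (Q y)) ∧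
      (∀ x, k * ‖x‖ ^ 2 ≤ inner ℝ (Q x) x) ∧
      ∀ x, 2 * inner ℝ (Q x) (A x) ≤ -(3 / 4) * ‖x‖ ^ 2 := by
  set e : ℝ → E →L[ℝ] E := fun t => NormedSpace.exp (t • A) with he
  have hed : ∀ t, HasDerivAt e (e t * A) t := fun t => hasDerivAt_exp_smul_const (𝕂 := ℝ) A t
  have hec : Continuous e := continuous_iff_continuousAt.2 fun t => (hed t).continuousAt
  set φ : ℝ → E →L[ℝ] E := fun t => (ContinuousLinearMap.adjoint (e t)) ∘L e t with hφ
  have hφc : Continuous φ :=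
    ((ContinuousLinearMap.adjoint (𝕜 := ℝ) (E := E) (F := E)).continuous.comp hec).clm_comp hec
  set Q : E →L[ℝ] E := ∫ t in (0 : ℝ)..T, φ t with hQ
  have hQi : ∀ x y, inner ℝ y (Q x) = ∫ t in (0 : ℝ)..T, inner ℝ (e t y) (e t x) := by
    intro x y
    have h1 := ContinuousLinearMap.intervalIntegral_comp_comm
      ((innerSL ℝ y).comp (ContinuousLinearMap.apply ℝ E x)) (hφc.intervalIntegrable 0 T
        (μ := volume))
    have h2 : ((innerSL ℝ y).comp (ContinuousLinearMap.apply ℝ E x)) Q = inner ℝ y (Q x) := by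
      simp
    rw [← h2, hQ, ← h1]
    refine intervalIntegral.integral_congr fun t _ => ?_
    simp [hφ, ContinuousLinearMap.adjoint_inner_right]
  have hsymm : ∀ x y, inner ℝ (Q x) y = inner ℝ x (Q y) := by
    intro x y
    rw [real_inner_comm, hQi, hQi]
    exact intervalIntegral.integral_congr fun t _ => real_inner_comm _ _
  obtain ⟨C, hC⟩ := isCompact_Icc.exists_bound_of_continuousOn (s := Icc 0 T)
    (f := fun t => e (-t)) (hec.comp continuous_neg).continuousOn
  set M : ℝ := |C| + 1 with hM
  have hM0 : 0 < M := by positivity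
  have hlow : ∀ t ∈ Icc 0 T, ∀ x, M⁻¹ ^ 2 * ‖x‖ ^ 2 ≤ inner ℝ (e t x) (e t x) := by
    intro t ht x
    have h1 : e (-t) * e t = 1 := by
      let : NormedAlgebra ℚ (E →L[ℝ] E) := NormedAlgebra.restrictScalars ℚ ℝ (E →L[ℝ] E)
      simp only [he, neg_smul]
      rw [← NormedSpace.exp_add_of_commute (Commute.refl (t • A)).neg_left]
      simp
    have h2 : e (-t) (e t x) = x := by
      have := congrArg (fun B : E →L[ℝ] E => B x) h1
      simpa using this
    have h3 : ‖x‖ ≤ M * ‖e t x‖ := by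
      conv_lhs => rw [← h2]
      refine (ContinuousLinearMap.le_opNorm _ _).trans ?_
      gcongr
      exact (hC t ht).trans ((le_abs_self C).trans (by linarith))
    rw [real_inner_self_eq_norm_sq, ← mul_pow]
    gcongr
    rw [inv_mul_le_iff₀ hM0]
    exact h3
  refine ⟨Q, T * M⁻¹ ^ 2, by positivity, hsymm, fun x => ?_, fun x => ?_⟩
  · rw [hsymm, hQi]
    have h1 : ∫ t in (0 : ℝ)..T, M⁻¹ ^ 2 * ‖x‖ ^ 2 = T * M⁻¹ ^ 2 * ‖x‖ ^ 2 := by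
      rw [intervalIntegral.integral_const, smul_eq_mul, sub_zero]; ring
    rw [← h1]
    refine intervalIntegral.integral_mono_on hT.le intervalIntegrable_const ?_
      fun t ht => hlow t ht x
    exact Continuous.intervalIntegrable (by fun_prop) _ _
  · rw [hsymm, hQi, ← intervalIntegral.integral_const_mul]
    -- the integrand is the derivative of `‖exp(tA) x‖²`
    have h1 : ∀ t ∈ uIcc 0 T, HasDerivAt (fun t => ‖e t x‖ ^ 2)
        (2 * inner ℝ (e t x) (e t (A x))) t := by
      intro t _
      have h2 : HasDerivAt (fun t => e t x) (e t (A x)) t := by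
        simpa using (hed t).clm_apply (hasDerivAt_const t x)
      exact h2.norm_sq
    rw [intervalIntegral.integral_eq_sub_of_hasDerivAt h1
      (Continuous.intervalIntegrable (by fun_prop) _ _)]
    have h3 : ‖e T x‖ ≤ 1 / 2 * ‖x‖ := by
      refine (ContinuousLinearMap.le_opNorm _ _).trans ?_
      gcongr
    have h4 : e 0 x = x := by simp [he]
    rw [h4]
    nlinarith [norm_nonneg x, norm_nonneg (e T x)]

/-- A quadratic Lyapunov function of the linearization is one of the nonlinear field on a ball on
which the quadratic remainder is small compared with the decrease. -/
theorem exists_isQuadraticLyapunov {n : ℕ}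
    {F : EuclideanSpace ℝ (Fin n) → EuclideanSpace ℝ (Fin n)}
    {A : EuclideanSpace ℝ (Fin n) →L[ℝ] EuclideanSpace ℝ (Fin n)} {L r T : ℝ} (hr : 0 < r)
    (hL : 0 ≤ L) (hFA : ∀ x ∈ Metric.closedBall 0 r, ‖F x - A x‖ ≤ L * ‖x‖ ^ 2)
    (hT : 0 < T) (hA : ‖NormedSpace.exp (T • A)‖ ≤ 1 / 2) :
    ∃ (ρ : ℝ) (W : EuclideanSpace ℝ (Fin n) → ℝ) (k₁ k₂ k₃ k₄ : ℝ),
      0 < ρ ∧ ρ ≤ r ∧ IsQuadraticLyapunov F ρ W k₁ k₂ k₃ k₄ := by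
  obtain ⟨Q, k, hk, hsymm, hlow, hdec⟩ := exists_lyapunov_operator hT hA
  set W : EuclideanSpace ℝ (Fin n) → ℝ := fun x => inner ℝ (Q x) x with hW
  have hWd : ∀ x, HasFDerivAt W (2 • innerSL ℝ (Q x)) x := by
    intro x
    have h1 := (Q.hasFDerivAt (x := x)).inner ℝ (hasFDerivAt_id x)
    refine h1.congr_fderiv ?_
    ext y
    simp [hsymm y x, real_inner_comm y (Q x)]
    ring
  have hfd : ∀ x y, fderiv ℝ W x y = 2 * inner ℝ (Q x) y := by
    intro x y
    rw [(hWd x).fderiv]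
    simp
  have hQx : ∀ x, ‖Q x‖ ≤ ‖Q‖ * ‖x‖ := Q.le_opNorm
  refine ⟨min r (1 / (8 * (‖Q‖ * L + 1))), W, k, ‖Q‖ + 1, 1 / 2, 2 * ‖Q‖ + 1, by positivity,
    min_le_left _ _, hk, by positivity, by norm_num, by positivity, ?_, fun x _ => hlow x,
    fun x _ => ?_, fun x hx => ?_, fun x _ => ?_⟩
  · exact (Q.contDiff.inner ℝ contDiff_id).contDiffOn
  · refine (real_inner_le_norm _ _).trans ?_
    nlinarith [hQx x, norm_nonneg x]
  · rw [mem_ball_zero_iff, lt_min_iff, lt_div_iff₀ (by positivity)] at hx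
    have h1 := hdec x
    have h2 : 2 * inner ℝ (Q x) (F x - A x) ≤ 1 / 4 * ‖x‖ ^ 2 := by
      have h3 : inner ℝ (Q x) (F x - A x) ≤ ‖Q‖ * ‖x‖ * (L * ‖x‖ ^ 2) :=
        (real_inner_le_norm _ _).trans (mul_le_mul (hQx x) (hFA x (by simpa using hx.1.le))
          (norm_nonneg _) (by positivity))
      have h4 : ‖x‖ * (‖Q‖ * L) ≤ 1 / 8 := by nlinarith [norm_nonneg x]
      have h5 := mul_le_mul_of_nonneg_right h4 (sq_nonneg ‖x‖)
      nlinarith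
    rw [hfd]
    rw [inner_sub_right] at h2
    linarith
  · refine ContinuousLinearMap.opNorm_le_bound _ (by positivity) fun y => ?_
    rw [hfd, norm_mul, Real.norm_ofNat]
    have h1 := norm_inner_le_norm (𝕜 := ℝ) (Q x) y
    have h2 := mul_le_mul_of_nonneg_right (hQx x) (norm_nonneg y)
    nlinarith [mul_nonneg (norm_nonneg x) (norm_nonneg y)]

/-! ### The control set and the control approximation error -/

theorem OptimalControlProblem.isCompact_controlSet {n m : ℕ} (P : OptimalControlProblem n m) :
    IsCompact P.controlSet := by
  have h : P.controlSet = (EuclideanSpace.equiv (Fin m) ℝ).toHomeomorph ⁻¹'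
      (univ.pi fun i => Icc (P.uMin i) (P.uMax i)) := by
    ext u
    simp only [mem_preimage, mem_univ_pi]
    exact Iff.rfl
  rw [h, Homeomorph.isCompact_preimage]
  exact isCompact_univ_pi fun i => isCompact_Icc

theorem OptimalControlProblem.convex_controlSet {n m : ℕ} (P : OptimalControlProblem n m) :
    Convex ℝ P.controlSet := by
  intro u hu v hv a b ha hb hab i
  exact (convex_Icc (P.uMin i) (P.uMax i)) (hu i) (hv i) ha hb hab

theorem OptimalControlProblem.exists_isControlLipschitz {n m : ℕ} (P : OptimalControlProblem n m)
    (r : ℝ) : ∃ Lu : ℝ, 0 < Lu ∧ P.IsControlLipschitz r Lu := by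
  obtain ⟨K, hK⟩ := (P.f_contDiffOn.mono (prod_mono (subset_univ _) Subset.rfl :
      Metric.closedBall (0 : EuclideanSpace ℝ (Fin n)) r ×ˢ P.controlSet ⊆ _)).exists_lipschitzOnWith
    one_ne_zero
    ((convex_closedBall 0 r).prod P.convex_controlSet)
    ((isCompact_closedBall 0 r).prod P.isCompact_controlSet)
  refine ⟨K + 1, by positivity, fun x hx u hu v hv => ?_⟩
  have h := hK.dist_le_mul (x, u) ⟨hx, hu⟩ (x, v) ⟨hx, hv⟩
  rw [Prod.dist_eq, dist_self, max_eq_right dist_nonneg, dist_eq_norm, dist_eq_norm] at h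
  refine h.trans ?_
  gcongr
  linarith

theorem OptimalControlProblem.continuous_closedLoop {n m : ℕ} (P : OptimalControlProblem n m)
    {κ : EuclideanSpace ℝ (Fin n) → EuclideanSpace ℝ (Fin m)} (hκ : Continuous κ)
    (hmem : ∀ x, κ x ∈ P.controlSet) : Continuous (P.closedLoop κ) :=
  P.f_contDiffOn.continuousOn.comp_continuous (continuous_id.prodMk hκ)
    fun x => ⟨mem_univ _, hmem x⟩

theorem norm_sub_le_maxControlError {n m : ℕ} {P : OptimalControlProblem n m}
    {κ κ' : EuclideanSpace ℝ (Fin n) → EuclideanSpace ℝ (Fin m)} (hκ : ∀ x, κ x ∈ P.controlSet)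
    (hκ' : ∀ x, κ' x ∈ P.controlSet) {r : ℝ} {x : EuclideanSpace ℝ (Fin n)}
    (hx : x ∈ Metric.closedBall 0 r) : ‖κ x - κ' x‖ ≤ maxControlError r κ κ' := by
  refine le_csSup ⟨Metric.diam P.controlSet, ?_⟩ ⟨x, hx, rfl⟩
  rintro _ ⟨y, -, rfl⟩
  change ‖κ y - κ' y‖ ≤ _
  rw [← dist_eq_norm]
  exact Metric.dist_le_diam_of_mem P.isCompact_controlSet.isBounded (hκ y) (hκ' y)

theorem maxControlError_nonneg {n m : ℕ} (r : ℝ)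
    (κ κ' : EuclideanSpace ℝ (Fin n) → EuclideanSpace ℝ (Fin m)) :
    0 ≤ maxControlError r κ κ' := by
  refine Real.sSup_nonneg ?_
  rintro _ ⟨y, -, rfl⟩
  exact norm_nonneg _

/-! ### Ultimate boundedness -/

theorem sq_lt_of_lt_mul_sqrt_div {a ρ k₁ k₂ : ℝ} (ha : 0 ≤ a) (hk₁ : 0 < k₁) (hk₂ : 0 < k₂)
    (h : a < ρ * √(k₁ / k₂)) : k₂ * a ^ 2 < k₁ * ρ ^ 2 := by
  have h1 : a ^ 2 < (ρ * √(k₁ / k₂)) ^ 2 := by gcongr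
  rw [mul_pow, Real.sq_sqrt (by positivity), ← mul_div_assoc, lt_div_iff₀ hk₂] at h1
  linarith

theorem IsQuadraticLyapunov.mem_ball_of_norm_lt {n : ℕ}
    {F : EuclideanSpace ℝ (Fin n) → EuclideanSpace ℝ (Fin n)} {ρ : ℝ}
    {W : EuclideanSpace ℝ (Fin n) → ℝ} {k₁ k₂ k₃ k₄ : ℝ}
    (hW : IsQuadraticLyapunov F ρ W k₁ k₂ k₃ k₄) (hρ : 0 < ρ) {x₀ : EuclideanSpace ℝ (Fin n)}
    (hx₀ : ‖x₀‖ < ρ * √(k₁ / k₂)) : x₀ ∈ Metric.ball 0 ρ := by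
  rcases eq_or_ne x₀ 0 with rfl | hne
  · exact Metric.mem_ball_self hρ
  have hpos : 0 < ‖x₀‖ := norm_pos_iff.2 hne
  -- both bounds on `W` at a nonzero point give `k₁ ≤ k₂`
  set z := (ρ / 2 / ‖x₀‖) • x₀ with hz
  have hzn : ‖z‖ = ρ / 2 := by
    rw [hz, norm_smul, Real.norm_of_nonneg (by positivity)]
    field_simp
  have hzb : z ∈ Metric.ball 0 ρ := by
    rw [mem_ball_zero_iff, hzn]; linarith
  have hk : k₁ ≤ k₂ := by
    have h := (hW.lower z hzb).trans (hW.upper z hzb)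
    rw [hzn] at h
    exact le_of_mul_le_mul_right h (by positivity)
  have hs : √(k₁ / k₂) ≤ 1 := by
    rw [Real.sqrt_le_one, div_le_one hW.k₂_pos]
    exact hk
  rw [mem_ball_zero_iff]
  exact hx₀.trans_le (mul_le_of_le_one_right hρ.le hs)

theorem IsQuadraticLyapunov.norm_integralCurve_le {n : ℕ}
    {F G : EuclideanSpace ℝ (Fin n) → EuclideanSpace ℝ (Fin n)} {ρ : ℝ}
    {W : EuclideanSpace ℝ (Fin n) → ℝ} {k₁ k₂ k₃ k₄ ε θ μ S : ℝ}
    (hW : IsQuadraticLyapunov F ρ W k₁ k₂ k₃ k₄) (hρ : 0 < ρ)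
    (hG : ∀ x ∈ Metric.ball 0 ρ, ‖G x - F x‖ ≤ ε) (hθ : 0 < θ) (hθ1 : θ < 1)
    (hμ0 : 0 ≤ μ) (hμε : k₄ * ε = θ * k₃ * μ) (hμ : μ < ρ * √(k₁ / k₂))
    {x : ℝ → EuclideanSpace ℝ (Fin n)} (hx : IsIntegralCurveOn x (fun _ => G) (Ico 0 S))
    (hx0 : ‖x 0‖ < ρ * √(k₁ / k₂)) {t : ℝ} (ht : t ∈ Ico 0 S) :
    x t ∈ Metric.ball 0 ρ ∧
      ‖x t‖ ≤ √(k₂ / k₁) *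
        max (‖x 0‖ * Real.exp (-((1 - θ) * k₃ / (2 * k₂)) * t)) μ := by
  have hk1 := hW.k₁_pos
  have hk2 := hW.k₂_pos
  obtain ⟨hb, hle⟩ := hW.integralCurve_bound hρ hG hθ hθ1 hμ0 hμε
    (sq_lt_of_lt_mul_sqrt_div hμ0 hk1 hk2 hμ) hx
    (sq_lt_of_lt_mul_sqrt_div (norm_nonneg _) hk1 hk2 hx0) (hW.mem_ball_of_norm_lt hρ hx0) ht
  refine ⟨hb, ?_⟩
  set E := Real.exp (-((1 - θ) * k₃ / (2 * k₂)) * t) with hE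
  have hE2 : Real.exp (-((1 - θ) * k₃ / k₂) * t) = E ^ 2 := by
    rw [hE, ← Real.exp_nat_mul]
    congr 1
    push_cast
    field_simp
  have hE0 : 0 < E := Real.exp_pos _
  have hmax : max (k₂ * ‖x 0‖ ^ 2 * E ^ 2) (k₂ * μ ^ 2) ≤ k₂ * max (‖x 0‖ * E) μ ^ 2 := by
    refine max_le ?_ ?_
    · rw [mul_assoc, ← mul_pow]
      gcongr
      exact le_max_left _ _
    · gcongr
      exact le_max_right _ _
  rw [hE2] at hle
  refine le_of_sq_le_sq ?_ (by positivity)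
  rw [mul_pow, Real.sq_sqrt (by positivity), div_mul_eq_mul_div, le_div_iff₀ hk1]
  linarith

/-- A continuous vector field that is close to `F` on the ball of radius `ρ` agrees there with a
bounded uniformly continuous one, whose integral curves exist for all times; the Lyapunov function
keeps the curves in the ball, where the two fields coincide. -/
theorem IsQuadraticLyapunov.exists_global_integralCurve {n : ℕ}
    {F g : EuclideanSpace ℝ (Fin n) → EuclideanSpace ℝ (Fin n)} {ρ : ℝ}
    {W : EuclideanSpace ℝ (Fin n) → ℝ} {k₁ k₂ k₃ k₄ ε θ μ : ℝ}
    (hW : IsQuadraticLyapunov F ρ W k₁ k₂ k₃ k₄) (hρ : 0 < ρ) (hgc : Continuous g)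
    (hg : ∀ x ∈ Metric.ball 0 ρ, ‖g x - F x‖ ≤ ε) (hθ : 0 < θ) (hθ1 : θ < 1)
    (hμ0 : 0 ≤ μ) (hμε : k₄ * ε = θ * k₃ * μ) (hμ : μ < ρ * √(k₁ / k₂))
    {x₀ : EuclideanSpace ℝ (Fin n)} (hx0 : ‖x₀‖ < ρ * √(k₁ / k₂)) :
    (∃ x : ℝ → EuclideanSpace ℝ (Fin n), x 0 = x₀ ∧
      IsIntegralCurveOn x (fun _ => g) (Ici 0)) ∧
    ∀ (S : ℝ) (x : ℝ → EuclideanSpace ℝ (Fin n)), 0 < S → x 0 = x₀ →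
      IsIntegralCurveOn x (fun _ => g) (Ico 0 S) →
      ∃ y : ℝ → EuclideanSpace ℝ (Fin n), EqOn y x (Ico 0 S) ∧
        IsIntegralCurveOn y (fun _ => g) (Ici 0) := by
  let χ : ContDiffBump (0 : EuclideanSpace ℝ (Fin n)) := ⟨ρ, ρ + 1, hρ, by linarith⟩
  set G : EuclideanSpace ℝ (Fin n) → EuclideanSpace ℝ (Fin n) := fun x => χ x • g x with hG
  have hGg : ∀ x ∈ Metric.ball 0 ρ, G x = g x := fun x hx => by
    simp [hG, χ.one_of_mem_closedBall (Metric.ball_subset_closedBall hx)]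
  have hGc : Continuous G := χ.continuous.smul hgc
  have hGs : HasCompactSupport G := χ.hasCompactSupport.smul_right
  have hGu : UniformContinuous G := hGs.uniformContinuous_of_continuous hGc
  obtain ⟨C, hC⟩ := hGs.exists_bound_of_continuous hGc
  have hM : ∀ x, ‖G x‖ ≤ C.toNNReal := fun x => (hC x).trans (Real.le_coe_toNNReal C)
  have hGF : ∀ x ∈ Metric.ball 0 ρ, ‖G x - F x‖ ≤ ε := fun x hx => by
    rw [hGg x hx]; exact hg x hx
  have hex := exists_integralCurveOn_Ici hGu hM
  have hconv : ∀ y : ℝ → EuclideanSpace ℝ (Fin n), ‖y 0‖ < ρ * √(k₁ / k₂) →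
      IsIntegralCurveOn y (fun _ => G) (Ici 0) → IsIntegralCurveOn y (fun _ => g) (Ici 0) := by
    intro y hy0 hy t ht
    have hb := (hW.norm_integralCurve_le hρ hGF hθ hθ1 hμ0 hμε hμ (S := t + 1)
      (hy.mono fun s hs => hs.1) hy0 ⟨ht, lt_add_one t⟩).1
    have := hy t ht
    simp only [hGg _ hb] at this
    exact this
  constructor
  · obtain ⟨x, hx, hxc⟩ := hex x₀
    exact ⟨x, hx, hconv x (by rwa [hx]) hxc⟩
  · intro S x hS hx hxc
    have hxG : IsIntegralCurveOn x (fun _ => G) (Ico 0 S) := by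
      intro t ht
      have hb := (hW.norm_integralCurve_le hρ hg hθ hθ1 hμ0 hμε hμ hxc (by rwa [hx]) ht).1
      simp only [hGg _ hb]
      exact hxc t ht
    obtain ⟨y, hyx, hy⟩ := IsIntegralCurveOn.exists_extension hGc hM hex hS hxG
    exact ⟨y, hyx, hconv y (by rwa [hyx ⟨le_rfl, hS⟩, hx]) hy⟩

/-- The time at which a decaying exponential crosses a positive level. -/
theorem exists_crossing_time {a μ α : ℝ} (hμ : 0 < μ) (hα : 0 < α) :
    ∃ T : ℝ, 0 ≤ T ∧ (∀ t, 0 ≤ t → t < T → μ ≤ a * Real.exp (-α * t)) ∧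
      ∀ t, T ≤ t → a * Real.exp (-α * t) ≤ μ := by
  rcases le_or_gt a μ with h | h
  · refine ⟨0, le_rfl, fun t h0 h1 => absurd h0 (not_le.2 h1), fun t ht => ?_⟩
    have h1 : Real.exp (-α * t) ≤ 1 := Real.exp_le_one_iff.2 (by nlinarith)
    nlinarith [Real.exp_pos (-α * t)]
  · have ha : 0 < a := hμ.trans h
    have hlog : 0 < Real.log (a / μ) := Real.log_pos ((one_lt_div hμ).2 h)
    refine ⟨Real.log (a / μ) / α, by positivity, fun t _ ht => ?_, fun t ht => ?_⟩
    · rw [lt_div_iff₀' hα, Real.lt_log_iff_exp_lt (by positivity), lt_div_iff₀ hμ] at ht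
      rw [neg_mul, Real.exp_neg, ← div_eq_mul_inv, le_div_iff₀ (Real.exp_pos _)]
      linarith
    · rw [div_le_iff₀' hα, Real.log_le_iff_le_exp (by positivity), div_le_iff₀ hμ] at ht
      rw [neg_mul, Real.exp_neg, ← div_eq_mul_inv, div_le_iff₀ (Real.exp_pos _)]
      linarith

theorem mainTheorem2 {n m : ℕ} (P : OptimalControlProblem n m)
    (uStar : EuclideanSpace ℝ (Fin n) → EuclideanSpace ℝ (Fin m))
    (hopt : P.IsOptimalFeedback uStar)
    (r : ℝ) (hr : 0 < r)
    (hJac : HasLipschitzJacobian (P.closedLoop uStar) r)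
    (hstab : IsExponentiallyStableAtZero (P.closedLoop uStar)) :
    -- a quadratic Lyapunov function exists on some ball, and `f` is Lipschitz in the control
    (∃ (ρ : ℝ) (W : EuclideanSpace ℝ (Fin n) → ℝ) (k₁ k₂ k₃ k₄ : ℝ),
      0 < ρ ∧ ρ ≤ r ∧ IsQuadraticLyapunov (P.closedLoop uStar) ρ W k₁ k₂ k₃ k₄) ∧
    (∃ Lu : ℝ, 0 < Lu ∧ P.IsControlLipschitz r Lu) ∧
    -- all such constants yield the following
    ∀ (ρ : ℝ) (W : EuclideanSpace ℝ (Fin n) → ℝ) (k₁ k₂ k₃ k₄ Lu θ : ℝ),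
      0 < ρ → ρ ≤ r → IsQuadraticLyapunov (P.closedLoop uStar) ρ W k₁ k₂ k₃ k₄ →
      0 < Lu → P.IsControlLipschitz r Lu → 0 < θ → θ < 1 →
      ∀ uHat : EuclideanSpace ℝ (Fin n) → EuclideanSpace ℝ (Fin m),
        Continuous uHat → (∀ x, uHat x ∈ P.controlSet) →
        maxControlError r uHat uStar < θ * k₃ / (Lu * k₄) * √(k₁ / k₂) * ρ →
        ∀ x₀ : EuclideanSpace ℝ (Fin n), ‖x₀‖ < ρ * √(k₁ / k₂) →
          -- a closed-loop trajectory exists for all times, and none stops in finite time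
          (∃ x : ℝ → EuclideanSpace ℝ (Fin n), x 0 = x₀ ∧
            IsIntegralCurveOn x (fun _ => P.closedLoop uHat) (Set.Ici 0)) ∧
          (∀ (S : ℝ) (x : ℝ → EuclideanSpace ℝ (Fin n)), 0 < S → x 0 = x₀ →
            IsIntegralCurveOn x (fun _ => P.closedLoop uHat) (Set.Ico 0 S) →
            ∃ y : ℝ → EuclideanSpace ℝ (Fin n), Set.EqOn y x (Set.Ico 0 S) ∧
              IsIntegralCurveOn y (fun _ => P.closedLoop uHat) (Set.Ici 0)) ∧
          -- exponential decay up to a finite time, then the ultimate bound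
          (0 < maxControlError r uHat uStar → ∃ T : ℝ, 0 ≤ T ∧
            ∀ x : ℝ → EuclideanSpace ℝ (Fin n), x 0 = x₀ →
              IsIntegralCurveOn x (fun _ => P.closedLoop uHat) (Set.Ici 0) →
              (∀ t, 0 ≤ t → t < T →
                ‖x t‖ ≤ √(k₂ / k₁) * ‖x₀‖ * Real.exp (-((1 - θ) * k₃ / (2 * k₂)) * t)) ∧
              (∀ t, T ≤ t →
                ‖x t‖ ≤ Lu * k₄ / (θ * k₃) * √(k₂ / k₁) * maxControlError r uHat uStar)) ∧
          -- without any error the exponential decay persists for all times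
          (maxControlError r uHat uStar = 0 →
            ∀ x : ℝ → EuclideanSpace ℝ (Fin n), x 0 = x₀ →
              IsIntegralCurveOn x (fun _ => P.closedLoop uHat) (Set.Ici 0) →
              ∀ t, 0 ≤ t →
                ‖x t‖ ≤ √(k₂ / k₁) * ‖x₀‖ * Real.exp (-((1 - θ) * k₃ / (2 * k₂)) * t)) := by
  refine ⟨?_, P.exists_isControlLipschitz r, ?_⟩
  · obtain ⟨A, L, hL, hFA⟩ := hJac.exists_norm_sub_le hr hstab.1
    obtain ⟨d, k, l, hd, hk, hl, hcurve⟩ :=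
      hopt.exists_exponential_curve hr hJac.1.continuousOn hstab
    obtain ⟨T, hT, hA⟩ := exists_norm_exp_le_half hL hFA hd hk hl hcurve
    exact exists_isQuadraticLyapunov hr hL hFA hT hA
  · intro ρ W k₁ k₂ k₃ k₄ Lu θ hρ hρr hW hLu0 hLu hθ hθ1 uHat huc hum hδ x₀ hx₀
    have hk1 := hW.k₁_pos
    have hk2 := hW.k₂_pos
    have hk3 := hW.k₃_pos
    have hk4 := hW.k₄_pos
    have hθ' : 0 < 1 - θ := by linarith
    have hδ0 := maxControlError_nonneg r uHat uStar
    set δ := maxControlError r uHat uStar with hδdef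
    set μ := Lu * k₄ / (θ * k₃) * δ with hμdef
    have hμ0 : 0 ≤ μ := by positivity
    have hclose : ∀ x ∈ Metric.ball 0 ρ,
        ‖P.closedLoop uHat x - P.closedLoop uStar x‖ ≤ Lu * δ := by
      intro x hx
      have hxr : x ∈ Metric.closedBall (0 : EuclideanSpace ℝ (Fin n)) r :=
        Metric.closedBall_subset_closedBall hρr (Metric.ball_subset_closedBall hx)
      refine (hLu x hxr _ (hum x) _ (hopt.1 x)).trans ?_
      gcongr
      exact norm_sub_le_maxControlError hum hopt.1 hxr
    have hμε : k₄ * (Lu * δ) = θ * k₃ * μ := by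
      rw [hμdef]; field_simp
    have hμ : μ < ρ * √(k₁ / k₂) := by
      have h1 : Lu * k₄ / (θ * k₃) * δ <
          Lu * k₄ / (θ * k₃) * (θ * k₃ / (Lu * k₄) * √(k₁ / k₂) * ρ) := by gcongr
      refine h1.trans_eq ?_
      field_simp
    have hbound : ∀ x : ℝ → EuclideanSpace ℝ (Fin n), x 0 = x₀ →
        IsIntegralCurveOn x (fun _ => P.closedLoop uHat) (Ici 0) → ∀ t, 0 ≤ t →
        ‖x t‖ ≤ √(k₂ / k₁) *
          max (‖x₀‖ * Real.exp (-((1 - θ) * k₃ / (2 * k₂)) * t)) μ := by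
      intro x hx hxc t ht
      have := (hW.norm_integralCurve_le hρ hclose hθ hθ1 hμ0 hμε hμ (S := t + 1)
        (hxc.mono fun s hs => hs.1) (by rwa [hx]) ⟨ht, lt_add_one t⟩).2
      rwa [hx] at this
    obtain ⟨hex, hext⟩ := hW.exists_global_integralCurve hρ (P.continuous_closedLoop huc hum)
      hclose hθ hθ1 hμ0 hμε hμ hx₀
    refine ⟨hex, hext, fun hpos => ?_, fun hzero x hx hxc t ht => ?_⟩
    · obtain ⟨T, hT0, hT1, hT2⟩ := exists_crossing_time (a := ‖x₀‖) (μ := μ)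
        (α := (1 - θ) * k₃ / (2 * k₂)) (by positivity) (by positivity)
      refine ⟨T, hT0, fun x hx hxc => ⟨fun t ht htT => ?_, fun t htT => ?_⟩⟩
      · have := hbound x hx hxc t ht
        rwa [max_eq_left (hT1 t ht htT), ← mul_assoc] at this
      · have := hbound x hx hxc t (hT0.trans htT)
        rw [max_eq_right (hT2 t htT)] at this
        refine this.trans_eq ?_
        rw [hμdef]; ring
    · have := hbound x hx hxc t ht
      have hμz : μ = 0 := by rw [hμdef, hzero, mul_zero]
      rwa [hμz, max_eq_left (by positivity), ← mul_assoc] at this
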